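/- Let $x$ be a zero-mean Gaussian random vector in $\mathbb{R}^2$ with covariance matrix $K_{xx}=\mathbb{E}[xx^T]$, let $I+K_{xx}=VDV^T$ with $V$ orthogonal and $D$ diagonal, and let $R_{BT}\in\mathbb{R}$ be the Berger--Tung rate at unit distortion, i.e. $\det D=2^{2R_{BT}}$ (equivalently $R_{BT}=\frac12\log_2\det(I+K_{xx})$). For a $2\times2$ covariance matrix $K$ and an integer matrix $A\in\mathbb{Z}^{2\times 2}$ with $\det A\ne0$, let $A(I+K)A^T=LL^T$ be the Cholesky decomposition ($L$ lower triangular with positive diagonal entries $\ell_{1,1},\ell_{2,2}$). The rate of successive integer-forcing source coding (IF-SUC) is $$R_{\text{IF-SUC}}(K;A)=2\max_{k=1,2}\tfrac12\log_2\big(\ell_{k,k}^2\big),\qquad R^{\rm opt}_{\text{IF-SUC}}(K)=\min_{A\in\mathbb{Z}^{2\times2},\ \det A\neq0}R_{\text{IF-SUC}}(K;A),$$ and $R^{\rm opt}_{\text{IF-SUC}}(D,U)$ denotes $R^{\rm opt}_{\text{IF-SUC}}(K)$ for the matrix $K$ with $I+K=UDU^T$, $U$ orthogonal. Let the random orthogonal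 $2\times2$ matrix $U$ be drawn from the circular real ensemble (CRE), i.e. its law is the probability measure on the orthogonal group that is invariant under left and right multiplication by orthogonal matrices. Then for every $\Delta R\in\mathbb{R}$, $$\Pr\left(R^{\rm opt}_{\text{IF-SUC}}(D,U)>R_{BT}+\Delta R\right)\le 2\pi\left(5+3\sqrt2\right)2^{-\Delta R},$$ and the same bound holds for the source precoded by $U$: $$\Pr\left(R^{\rm opt}_{\text{IF-SUC}}(UK_{xx}U^T)>R_{BT}+\Delta R\right)\le 2\pi\left(5+3\sqrt2\right)2^{-\Delta R}.$$ -/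

import Mathlib

open MeasureTheory ProbabilityTheory Matrix

noncomputable section

namespace IFSource

/-- The covariance matrix `𝔼[x xᵀ]` of a zero-mean random vector `x`. -/
def covariance {n : ℕ} {Ω : Type*} [MeasurableSpace Ω]
    (x : Ω → EuclideanSpace ℝ (Fin n)) (μ : Measure Ω) : Matrix (Fin n) (Fin n) ℝ :=
  Matrix.of fun i j => ∫ ω, x ω i * x ω j ∂μ

/-- `L` is the Cholesky factor of `M`: `M = L Lᵀ` with `L` lower triangular and with positive
diagonal. Every positive definite `M` has exactly one such factor. -/
def IsCholeskyFactor {n : ℕ} (M L : Matrix (Fin n) (Fin n) ℝ) : Prop :=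
  (∀ i j, i < j → L i j = 0) ∧ (∀ i, 0 < L i i) ∧ M = L * Lᵀ

open Classical in
/-- The Cholesky factor of a positive definite matrix (zero if there is none). -/
def choleskyFactor {n : ℕ} (M : Matrix (Fin n) (Fin n) ℝ) : Matrix (Fin n) (Fin n) ℝ :=
  if h : ∃ L, IsCholeskyFactor M L then h.choose else 0

/-- `R_{IF-SUC,k}(K; A) = ½ log₂ ℓ_{k,k}²`, where `A (I + K) Aᵀ = L Lᵀ` is the Cholesky
decomposition (unit distortion). -/
def sucRateAt {n : ℕ} (K : Matrix (Fin n) (Fin n) ℝ) (A : Matrix (Fin n) (Fin n) ℤ)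
    (k : Fin n) : ℝ :=
  1 / 2 * Real.logb 2
    ((choleskyFactor (A.map (Int.cast : ℤ → ℝ) * (1 + K) * (A.map (Int.cast : ℤ → ℝ))ᵀ)) k k ^ 2)

/-- The sum rate of successive integer-forcing source coding with the integer matrix `A`. -/
def sucRate {n : ℕ} (K : Matrix (Fin n) (Fin n) ℝ) (A : Matrix (Fin n) (Fin n) ℤ) : ℝ :=
  n * ⨆ k : Fin n, sucRateAt K A k

/-- The sum rate of successive integer-forcing source coding, optimized over all full-rank
integer matrices. -/
def sucOptRate {n : ℕ} (K : Matrix (Fin n) (Fin n) ℝ) : ℝ :=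
  ⨅ A : {A : Matrix (Fin n) (Fin n) ℤ // A.det ≠ 0}, sucRate K A.1

/-- The same rate as a function of `(D, U)`, i.e. for the covariance matrix `K` with
`I + K = U D Uᵀ`. -/
def sucOptRateDU {n : ℕ} (D : Matrix (Fin n) (Fin n) ℝ)
    (U : Matrix.orthogonalGroup (Fin n) ℝ) : ℝ :=
  sucOptRate ((U : Matrix (Fin n) (Fin n) ℝ) * D * (U : Matrix (Fin n) (Fin n) ℝ)ᵀ - 1)

/-- The class `𝔻(R, n)` of diagonal `n × n` matrices with determinant `2 ^ (2R)`. -/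
def diagClass (R : ℝ) (n : ℕ) : Set (Matrix (Fin n) (Fin n) ℝ) :=
  {D | D.IsDiag ∧ D.det = (2 : ℝ) ^ (2 * R)}

instance instMeasurableSpaceOrthogonal (n : ℕ) :
    MeasurableSpace (Matrix.orthogonalGroup (Fin n) ℝ) := borel _

instance instBorelSpaceOrthogonal (n : ℕ) :
    BorelSpace (Matrix.orthogonalGroup (Fin n) ℝ) := ⟨rfl⟩

/-- The random orthogonal matrix `U` is drawn from the circular real ensemble: its law is a
probability measure invariant under left and right multiplication by orthogonal matrices. -/
structure IsCRE {n : ℕ} {Ω : Type*} [MeasurableSpace Ω]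
    (U : Ω → Matrix.orthogonalGroup (Fin n) ℝ) (P : Measure Ω) : Prop where
  isProbabilityMeasure : IsProbabilityMeasure P
  aemeasurable : AEMeasurable U P
  left_invariant : ∀ V : Matrix.orthogonalGroup (Fin n) ℝ,
    IdentDistrib (fun ω => V * U ω) U P P
  right_invariant : ∀ V : Matrix.orthogonalGroup (Fin n) ℝ,
    IdentDistrib (fun ω => U ω * V) U P P

end IFSource

end

/-! Let `Q` be the quadratic form of `I + K`, of determinant `2 ^ (2R)`. If `Q ≥ 2 ^ (R - T)` on
nonzero integer vectors, Hermite reduction gives a basis of `ℤ²` whose first vector `v` has `Q v ≤ 2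
* 2 ^ R`. Using that basis as the rows of `A`, the squared Cholesky entries are `Q v` and `2 ^ (2R)
/ Q v`, both at most `2 ^ (R + T)` once `T ≥ 1`. So an outage forces a nonzero integer `v` with `Q v
< 2 ^ (R - T)` (`exists_binaryForm_lt_of_lt_sucOptRate`).

In the eigenbasis `Q v = d_j ⟨v, u_j⟩² + d_k ⟨v, u_k⟩²` with `d_k ≤ d_j`, hence `‖v‖ < β` and `|⟨v,
u_j⟩| < α`, where `α * β = 2 ^ (-T)`. By invariance the second event has probability at most `2α /
‖v‖`. The sup-norm shell of radius `m` has `8m` points, each of norm at least `m`, so it contributes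
at most `16α`. At most `β` shells occur, and the total `16 * 2 ^ (-T)` is below the claimed bound.
For `T < 1` the bound exceeds `1`.

Precoding by `U` replaces `U` by `U * V`, which is again CRE. -/

namespace IFSource

/-! ### Reduction of binary quadratic forms -/

/-- The binary quadratic form `p x² + 2 q x y + r y²`. -/
def binaryForm (p q r x y : ℝ) : ℝ := p * x ^ 2 + 2 * q * x * y + r * y ^ 2

/-- Hermite-type reduction: a binary form of determinant `δ` that is bounded away from zero on
nonzero integer vectors takes a value `v` with `v ^ 2 ≤ 4 δ` at the first vector of some basis
of `ℤ²`. -/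
theorem exists_basis_binaryForm_sq_le {p q r c : ℝ} (hc : 0 < c)
    (h : ∀ x y : ℤ, (x, y) ≠ 0 → c ≤ binaryForm p q r x y) :
    ∃ x y z w : ℤ, x * w - y * z = 1 ∧
      binaryForm p q r x y ^ 2 ≤ 4 * (p * r - q ^ 2) := by
  let f : {v : ℤ × ℤ // v ≠ 0} → ℝ := fun v => binaryForm p q r v.1.1 v.1.2
  have : Nonempty {v : ℤ × ℤ // v ≠ 0} := ⟨⟨(1, 0), by simp⟩⟩
  have hbdd : BddBelow (Set.range f) := ⟨c, by rintro _ ⟨v, rfl⟩; exact h _ _ v.2⟩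
  have hm : c ≤ iInf f := le_ciInf fun v => h _ _ v.2
  have hle : ∀ x y : ℤ, (x, y) ≠ 0 → iInf f ≤ binaryForm p q r x y := fun x y hxy =>
    ciInf_le hbdd ⟨(x, y), hxy⟩
  -- A value below twice the infimum suffices, so attainment is not needed. The factor 2 is below 4,
  -- so a vector divisible by `g ≥ 2`, whose value is at least `4 * iInf f`, is excluded.
  obtain ⟨⟨⟨x, y⟩, hxy⟩, hlt⟩ : ∃ v, f v < 2 * iInf f :=
    exists_lt_of_ciInf_lt (by linarith)
  change binaryForm p q r x y < _ at hlt
  have hcop : IsCoprime x y := by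
    rw [Int.isCoprime_iff_gcd_eq_one]
    by_contra hg
    have hg0 : Int.gcd x y ≠ 0 := by
      intro h0
      rw [Int.gcd_eq_zero_iff] at h0
      exact hxy (by ext <;> simp [h0])
    obtain ⟨u, hu⟩ := Int.gcd_dvd_left x y
    obtain ⟨v, hv⟩ := Int.gcd_dvd_right x y
    generalize Int.gcd x y = g at hg hg0 hu hv
    have huv : (u, v) ≠ 0 := by
      intro h0
      simp only [Prod.mk_eq_zero] at h0
      exact hxy (by ext <;> simp [hu, hv, h0])
    have hscale : binaryForm p q r x y = g ^ 2 * binaryForm p q r u v := by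
      subst hu hv
      simp only [binaryForm]
      push_cast
      ring
    have hg2 : (2 : ℝ) ≤ g := by
      have : 2 ≤ g := by omega
      exact_mod_cast this
    have := hle u v huv
    have hg4 : (4 : ℝ) ≤ (g : ℝ) ^ 2 := by nlinarith
    nlinarith
  obtain ⟨b, a, hab⟩ := hcop
  have hxy0 := hle x y hxy
  set Q := binaryForm p q r x y with hQ
  have hQ0 : 0 < Q := by linarith
  set B : ℝ := p * x * (-a) + q * (x * b + y * (-a)) + r * y * b with hB
  -- `B` is the bilinear pairing of `(x, y)` with its Bézout partner `(-a, b)`; subtracting `k`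
  -- times the first vector brings it down to at most `Q / 2`.
  set k := round (B / Q)
  have hk : |B - k * Q| ≤ Q / 2 := by
    have := abs_sub_round (B / Q)
    have h2 : B - k * Q = (B / Q - k) * Q := by field_simp
    rw [h2, abs_mul, abs_of_pos hQ0]
    nlinarith
  refine ⟨x, y, -a - k * x, b - k * y, by linarith, ?_⟩
  have hne : (-a - k * x, b - k * y) ≠ (0 : ℤ × ℤ) := by
    intro h0
    simp only [Prod.mk_eq_zero] at h0
    have h1 : a = -(k * x) := by linarith
    have h2 : b = k * y := by linarith
    rw [h1, h2] at hab
    ring_nf at hab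
    simp at hab
  have hz := hle _ _ hne
  have habR : (b : ℝ) * x + a * y = 1 := by exact_mod_cast hab
  have hid : Q * binaryForm p q r ((-a - k * x : ℤ) : ℝ) ((b - k * y : ℤ) : ℝ)
      - (B - k * Q) ^ 2 = (p * r - q ^ 2) * (b * x + a * y) ^ 2 := by
    simp only [hQ, hB, binaryForm]
    push_cast
    ring
  rw [habR] at hid
  have hsq : (B - k * Q) ^ 2 ≤ (Q / 2) ^ 2 := sq_le_sq' (by linarith [abs_le.1 hk]) (abs_le.1 hk).2
  -- With `z` the second basis vector, `Q z ≥ iInf f > Q / 2`, so the Gram identity gives `Q² / 2 ≤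
  -- Q * Q z ≤ δ + Q² / 4`.
  nlinarith

/-! ### Cholesky factors and the rate of a fixed integer matrix -/

theorem exists_isCholeskyFactor_two {M : Matrix (Fin 2) (Fin 2) ℝ} (hM : M.PosDef) :
    ∃ L, IsCholeskyFactor M L := by
  have h0 : 0 < M 0 0 := hM.diag_pos
  have hd := hM.det_pos
  have hs : M 1 0 = M 0 1 := by simpa using hM.isHermitian.apply 0 1
  rw [det_fin_two, hs] at hd
  have h1 : 0 < M 1 1 - (M 0 1) ^ 2 / M 0 0 := by
    have : M 1 1 - (M 0 1) ^ 2 / M 0 0 = (M 0 0 * M 1 1 - M 0 1 * M 0 1) / M 0 0 := by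
      field_simp
    rw [this]
    positivity
  have hr0 : √(M 0 0) ≠ 0 := (Real.sqrt_pos.2 h0).ne'
  refine ⟨!![√(M 0 0), 0; M 0 1 / √(M 0 0), √(M 1 1 - (M 0 1) ^ 2 / M 0 0)], ?_, ?_, ?_⟩
  · intro i j hij
    fin_cases i <;> fin_cases j <;> simp_all
  · intro i
    fin_cases i
    · simpa using h0
    · simpa using h1
  · ext i j
    fin_cases i <;> fin_cases j <;> simp [Matrix.mul_apply, Fin.sum_univ_two, hs]
    · rw [Real.mul_self_sqrt h0.le]
    · field_simp
    · field_simp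
    · rw [Real.mul_self_sqrt h1.le, div_mul_div_comm, Real.mul_self_sqrt h0.le]
      ring

theorem isCholeskyFactor_choleskyFactor {n : ℕ} {M : Matrix (Fin n) (Fin n) ℝ}
    (h : ∃ L, IsCholeskyFactor M L) : IsCholeskyFactor M (choleskyFactor M) := by
  rw [choleskyFactor, dif_pos h]
  exact h.choose_spec

theorem choleskyFactor_zero_sq {M : Matrix (Fin 2) (Fin 2) ℝ} (hM : M.PosDef) :
    choleskyFactor M 0 0 ^ 2 = M 0 0 := by
  obtain ⟨h1, -, h3⟩ := isCholeskyFactor_choleskyFactor (exists_isCholeskyFactor_two hM)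
  have h01 := h1 0 1 (by simp)
  conv_rhs => rw [h3]
  simp [Matrix.mul_apply, Fin.sum_univ_two, h01, sq]

theorem choleskyFactor_mul_sq {M : Matrix (Fin 2) (Fin 2) ℝ} (hM : M.PosDef) :
    choleskyFactor M 0 0 ^ 2 * choleskyFactor M 1 1 ^ 2 = M.det := by
  obtain ⟨h1, -, h3⟩ := isCholeskyFactor_choleskyFactor (exists_isCholeskyFactor_two hM)
  have h01 := h1 0 1 (by simp)
  conv_rhs => rw [h3, det_mul, det_transpose, det_fin_two, h01]
  ring

/-- `A M Aᵀ` is positive definite for every nonsingular integer matrix `A`. -/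
theorem posDef_intCast_mul_mul_transpose {n : ℕ} {M : Matrix (Fin n) (Fin n) ℝ} (hM : M.PosDef)
    {A : Matrix (Fin n) (Fin n) ℤ} (hA : A.det ≠ 0) :
    (A.map (Int.cast : ℤ → ℝ) * M * (A.map (Int.cast : ℤ → ℝ))ᵀ).PosDef := by
  have hdet : (A.map (Int.cast : ℤ → ℝ)).det ≠ 0 := by
    have := Int.cast_det (R := ℝ) A
    rw [← this]
    exact_mod_cast hA
  have hu : IsUnit (A.map (Int.cast : ℤ → ℝ)) :=
    (Matrix.isUnit_iff_isUnit_det _).2 hdet.isUnit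
  have := hM.mul_mul_conjTranspose_same (B := A.map (Int.cast : ℤ → ℝ))
    (Matrix.vecMul_injective_iff_isUnit.2 hu)
  rwa [conjTranspose_eq_transpose_of_trivial] at this

theorem det_intCast_mul_mul_transpose {n : ℕ} (M : Matrix (Fin n) (Fin n) ℝ)
    (A : Matrix (Fin n) (Fin n) ℤ) :
    (A.map (Int.cast : ℤ → ℝ) * M * (A.map (Int.cast : ℤ → ℝ))ᵀ).det = (A.det : ℝ) ^ 2 * M.det := by
  rw [det_mul, det_mul, det_transpose, Int.cast_det]
  ring

/-- Twice a maximum dominates the sum, and `(det A)² ≥ 1`. This lower bound, uniform in `A`, makes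
the real infimum in `sucOptRate` a genuine one rather than a default value. -/
theorem logb_det_le_sucRate {K : Matrix (Fin 2) (Fin 2) ℝ} (hK : (1 + K).PosDef)
    {A : Matrix (Fin 2) (Fin 2) ℤ} (hA : A.det ≠ 0) :
    1 / 2 * Real.logb 2 (1 + K).det ≤ sucRate K A := by
  have hP := posDef_intCast_mul_mul_transpose hK hA
  have hprod := choleskyFactor_mul_sq hP
  obtain ⟨-, hpos, -⟩ := isCholeskyFactor_choleskyFactor (exists_isCholeskyFactor_two hP)
  have h0 := le_ciSup (Set.finite_range (sucRateAt K A)).bddAbove 0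
  have h1 := le_ciSup (Set.finite_range (sucRateAt K A)).bddAbove 1
  have hsum : sucRateAt K A 0 + sucRateAt K A 1
      = 1 / 2 * Real.logb 2 ((A.det : ℝ) ^ 2 * (1 + K).det) := by
    rw [← det_intCast_mul_mul_transpose, ← hprod, Real.logb_mul (pow_pos (hpos 0) 2).ne'
      (pow_pos (hpos 1) 2).ne', sucRateAt, sucRateAt]
    ring
  have hA1 : (1 : ℝ) ≤ (A.det : ℝ) ^ 2 := by
    have : 1 ≤ A.det ^ 2 := by
      have := sq_pos_of_ne_zero hA
      omega
    exact_mod_cast this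
  have hmono : Real.logb 2 (1 + K).det ≤ Real.logb 2 ((A.det : ℝ) ^ 2 * (1 + K).det) := by
    apply Real.logb_le_logb_of_le one_lt_two hK.det_pos
    nlinarith [hK.det_pos]
  rw [sucRate]
  push_cast
  linarith

theorem sucOptRate_le_sucRate {K : Matrix (Fin 2) (Fin 2) ℝ} (hK : (1 + K).PosDef)
    {A : Matrix (Fin 2) (Fin 2) ℤ} (hA : A.det ≠ 0) : sucOptRate K ≤ sucRate K A :=
  ciInf_le (f := fun A : {A : Matrix (Fin 2) (Fin 2) ℤ // A.det ≠ 0} => sucRate K A.1)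
    ⟨_, by rintro _ ⟨B, rfl⟩; exact logb_det_le_sucRate hK B.2⟩ ⟨A, hA⟩

theorem sucRate_le_of_sq_le {K : Matrix (Fin 2) (Fin 2) ℝ} (hK : (1 + K).PosDef)
    {A : Matrix (Fin 2) (Fin 2) ℤ} (hA : A.det ≠ 0) {t : ℝ}
    (h0 : choleskyFactor
      (A.map (Int.cast : ℤ → ℝ) * (1 + K) * (A.map (Int.cast : ℤ → ℝ))ᵀ) 0 0 ^ 2 ≤ 2 ^ t)
    (h1 : choleskyFactor
      (A.map (Int.cast : ℤ → ℝ) * (1 + K) * (A.map (Int.cast : ℤ → ℝ))ᵀ) 1 1 ^ 2 ≤ 2 ^ t) :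
    sucRate K A ≤ t := by
  have hP := posDef_intCast_mul_mul_transpose hK hA
  obtain ⟨-, hpos, -⟩ := isCholeskyFactor_choleskyFactor (exists_isCholeskyFactor_two hP)
  have hsup : ⨆ k, sucRateAt K A k ≤ 1 / 2 * t := by
    refine ciSup_le fun k => ?_
    rw [sucRateAt]
    refine mul_le_mul_of_nonneg_left ?_ (by norm_num)
    rw [Real.logb_le_iff_le_rpow one_lt_two (pow_pos (hpos k) 2)]
    fin_cases k
    · exact h0
    · exact h1
  rw [sucRate]
  push_cast
  linarith

/-- If the optimal rate exceeds `R + ΔR`, some nonzero integer vector is shorter, in the form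
`I + K`, than `2 ^ (R - ΔR)`. -/
theorem exists_binaryForm_lt_of_lt_sucOptRate {K : Matrix (Fin 2) (Fin 2) ℝ}
    (hK : (1 + K).PosDef) {R T : ℝ} (hdet : (1 + K).det = 2 ^ (2 * R)) (hT : 1 ≤ T)
    (h : R + T < sucOptRate K) :
    ∃ x y : ℤ, (x, y) ≠ 0 ∧
      binaryForm ((1 + K) 0 0) ((1 + K) 0 1) ((1 + K) 1 1) x y < 2 ^ (R - T) := by
  by_contra! hcon
  have hs : (1 + K) 1 0 = (1 + K) 0 1 := by simpa only [star_trivial] using hK.isHermitian.apply 0 1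
  set M := 1 + K with hM
  obtain ⟨x, y, z, w, h1, hle⟩ :=
    exists_basis_binaryForm_sq_le (by positivity : (0 : ℝ) < 2 ^ (R - T)) hcon
  have hxy : (x, y) ≠ 0 := by
    intro h0
    simp only [Prod.mk_eq_zero] at h0
    simp [h0] at h1
  have hge := hcon x y hxy
  set A : Matrix (Fin 2) (Fin 2) ℤ := !![x, y; z, w] with hA
  have hdA : A.det = 1 := by rw [hA, det_fin_two_of, h1]
  have hA0 : A.det ≠ 0 := by simp [hdA]
  have hP := posDef_intCast_mul_mul_transpose hK hA0
  have h00 := choleskyFactor_zero_sq hP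
  have hprod := choleskyFactor_mul_sq hP
  rw [det_intCast_mul_mul_transpose, hdA, hdet, h00] at hprod
  rw [det_fin_two, hs] at hdet
  have hQ : (A.map (Int.cast : ℤ → ℝ) * M * (A.map (Int.cast : ℤ → ℝ))ᵀ) 0 0
      = binaryForm (M 0 0) (M 0 1) (M 1 1) x y := by
    simp [hA, Matrix.mul_apply, Fin.sum_univ_two, hs, binaryForm]
    ring
  rw [hQ] at h00 hprod
  set Q := binaryForm (M 0 0) (M 0 1) (M 1 1) x y
  have hsq : (2 : ℝ) ^ (2 * R) = (2 ^ R) ^ 2 := by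
    rw [← Real.rpow_natCast, ← Real.rpow_mul zero_le_two]
    congr 1
    push_cast
    ring
  have hR : (0 : ℝ) < 2 ^ R := by positivity
  -- Here `T ≥ 1` absorbs the constant 2 lost in the reduction.
  have h2 : (2 : ℝ) ≤ 2 ^ T := by
    simpa using Real.rpow_le_rpow_of_exponent_le one_le_two hT
  have hQpos : 0 < Q := lt_of_lt_of_le (by positivity) hge
  have hQle : Q ≤ 2 ^ (R + T) := by
    have : Q ≤ 2 * 2 ^ R := by
      refine (sq_le_sq₀ hQpos.le (by positivity)).1 ?_
      nlinarith
    rw [Real.rpow_add zero_lt_two]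
    nlinarith
  have hmul : (2 : ℝ) ^ (R - T) * 2 ^ (R + T) = 2 ^ (2 * R) := by
    rw [← Real.rpow_add zero_lt_two]
    congr 1
    ring
  have h11 : choleskyFactor
      (A.map (Int.cast : ℤ → ℝ) * M * (A.map (Int.cast : ℤ → ℝ))ᵀ) 1 1 ^ 2 ≤ 2 ^ (R + T) := by
    have hpos : (0 : ℝ) < 2 ^ (R + T) := by positivity
    refine le_of_mul_le_mul_left ?_ hQpos
    rw [hprod, Int.cast_one, one_pow, one_mul, ← hmul]
    exact mul_le_mul_of_nonneg_right hge hpos.le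
  exact absurd h (not_lt.2 ((sucOptRate_le_sucRate hK hA0).trans
    (sucRate_le_of_sq_le hK hA0 (h00.trans_le hQle) h11)))

/-! ### Small-ball probability for a random direction -/

/-- The `j`-th coordinate of `Vᵀ v`, where `v = (a, b)`. -/
def columnDot (a b : ℝ) (j : Fin 2) (V : Matrix.orthogonalGroup (Fin 2) ℝ) : ℝ :=
  a * (V : Matrix (Fin 2) (Fin 2) ℝ) 0 j + b * (V : Matrix (Fin 2) (Fin 2) ℝ) 1 j

theorem measurable_columnDot (a b : ℝ) (j : Fin 2) : Measurable (columnDot a b j) := by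
  apply Continuous.measurable
  unfold columnDot
  have h : ∀ i, Continuous
      fun V : Matrix.orthogonalGroup (Fin 2) ℝ => (V : Matrix (Fin 2) (Fin 2) ℝ) i j :=
    fun i => continuous_subtype_val.matrix_elem i j
  exact ((h 0).const_mul a).add ((h 1).const_mul b)

theorem measurableSet_abs_columnDot_lt (a b : ℝ) (j : Fin 2) (t : ℝ) :
    MeasurableSet {V | |columnDot a b j V| < t} :=
  measurableSet_lt (measurable_columnDot a b j).abs measurable_const

/-- The rotation by the angle `θ`. -/
noncomputable def rotation (θ : ℝ) : Matrix.orthogonalGroup (Fin 2) ℝ :=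
  ⟨!![Real.cos θ, -Real.sin θ; Real.sin θ, Real.cos θ], by
    rw [Matrix.mem_orthogonalGroup_iff]
    ext i j
    fin_cases i <;> fin_cases j <;>
      simp [Matrix.mul_apply, Fin.sum_univ_two] <;>
      nlinarith [Real.sin_sq_add_cos_sq θ]⟩

theorem columnDot_rotation_mul (φ θ : ℝ) (j : Fin 2) (V : Matrix.orthogonalGroup (Fin 2) ℝ) :
    columnDot (Real.cos φ) (Real.sin φ) j (rotation θ * V)
      = columnDot (Real.cos (φ - θ)) (Real.sin (φ - θ)) j V := by
  simp [columnDot, rotation, Matrix.mul_apply, Fin.sum_univ_two, Real.cos_sub, Real.sin_sub]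
  ring

theorem column_sq_add_sq (V : Matrix.orthogonalGroup (Fin 2) ℝ) (j : Fin 2) :
    (V : Matrix (Fin 2) (Fin 2) ℝ) 0 j ^ 2 + (V : Matrix (Fin 2) (Fin 2) ℝ) 1 j ^ 2 = 1 := by
  have h := congrFun (congrFun ((Matrix.mem_orthogonalGroup_iff' (Fin 2) ℝ).1 V.2) j) j
  simpa [Matrix.mul_apply, Fin.sum_univ_two, Matrix.star_apply, sq] using h

theorem row_dot (V : Matrix.orthogonalGroup (Fin 2) ℝ) (i k : Fin 2) :
    (V : Matrix (Fin 2) (Fin 2) ℝ) i 0 * (V : Matrix (Fin 2) (Fin 2) ℝ) k 0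
      + (V : Matrix (Fin 2) (Fin 2) ℝ) i 1 * (V : Matrix (Fin 2) (Fin 2) ℝ) k 1
      = if i = k then 1 else 0 := by
  have h := congrFun (congrFun ((Matrix.mem_orthogonalGroup_iff (Fin 2) ℝ).1 V.2) i) k
  simpa [Matrix.mul_apply, Fin.sum_univ_two, Matrix.star_apply, Matrix.one_apply] using h

theorem columnDot_sq_add_sq (a b : ℝ) (V : Matrix.orthogonalGroup (Fin 2) ℝ) :
    columnDot a b 0 V ^ 2 + columnDot a b 1 V ^ 2 = a ^ 2 + b ^ 2 := by
  have h0 := row_dot V 0 0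
  have h1 := row_dot V 1 1
  have h2 := row_dot V 0 1
  simp only [if_true, Fin.zero_eq_one_iff, OfNat.ofNat_ne_one, if_false] at h0 h1 h2
  simp only [columnDot]
  linear_combination a ^ 2 * h0 + b ^ 2 * h1 + 2 * a * b * h2

/-- Two unit vectors nearly orthogonal to the same column are nearly parallel: the sine of their
angle is their determinant, computed in the frame of the column and its quarter turn. -/
theorem abs_sin_sub_lt_of_abs_columnDot_lt {φ θ t : ℝ} {j : Fin 2}
    {V : Matrix.orthogonalGroup (Fin 2) ℝ}
    (h1 : |columnDot (Real.cos φ) (Real.sin φ) j V| < t)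
    (h2 : |columnDot (Real.cos θ) (Real.sin θ) j V| < t) : |Real.sin (φ - θ)| < 2 * t := by
  have hV := column_sq_add_sq V j
  set c := (V : Matrix (Fin 2) (Fin 2) ℝ) 0 j with hc
  set s := (V : Matrix (Fin 2) (Fin 2) ℝ) 1 j with hs
  set X := columnDot (Real.cos φ) (Real.sin φ) j V with hX
  set Y := columnDot (Real.cos θ) (Real.sin θ) j V with hY
  set X' := Real.cos φ * (-s) + Real.sin φ * c with hX'
  set Y' := Real.cos θ * (-s) + Real.sin θ * c with hY'
  have key : Real.sin (φ - θ) = X' * Y - X * Y' := by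
    rw [Real.sin_sub]
    simp only [hX, hY, hX', hY', columnDot, ← hc, ← hs]
    linear_combination (-Real.sin φ * Real.cos θ + Real.cos φ * Real.sin θ) * hV
  have hX1 : |X'| ≤ 1 := by
    rw [← sq_le_one_iff_abs_le_one]
    have : X' ^ 2 + X ^ 2 = 1 := by
      simp only [hX, hX', columnDot, ← hc, ← hs]
      linear_combination (Real.sin φ ^ 2 + Real.cos φ ^ 2) * hV + Real.sin_sq_add_cos_sq φ
    nlinarith
  have hY1 : |Y'| ≤ 1 := by
    rw [← sq_le_one_iff_abs_le_one]
    have : Y' ^ 2 + Y ^ 2 = 1 := by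
      simp only [hY, hY', columnDot, ← hc, ← hs]
      linear_combination (Real.sin θ ^ 2 + Real.cos θ ^ 2) * hV + Real.sin_sq_add_cos_sq θ
    nlinarith
  calc |Real.sin (φ - θ)| = |X' * Y - X * Y'| := by rw [key]
    _ ≤ |X'| * |Y| + |X| * |Y'| := by
      rw [← abs_mul, ← abs_mul]
      exact abs_sub _ _
    _ ≤ 1 * |Y| + |X| * 1 := by gcongr
    _ < 2 * t := by linarith

/-- Jordan's inequality `sin x ≥ 2x / π`, applied to the angle or to its supplement. -/
theorem two_div_le_abs_sin_pi_mul_sub_div {N k l : ℕ} (hk : k < N) (hl : l < N) (hkl : k ≠ l) :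
    2 / N ≤ |Real.sin (Real.pi * k / N - Real.pi * l / N)| := by
  wlog h : l < k generalizing k l
  · have := this hl hk hkl.symm (by omega)
    rwa [← abs_neg, ← Real.sin_neg, neg_sub] at this
  have hN : (0 : ℝ) < N := by exact_mod_cast (by omega : 0 < N)
  have hpi := Real.pi_pos
  have h1 : (l : ℝ) + 1 ≤ k := by exact_mod_cast h
  have h2 : (k : ℝ) - l + 1 ≤ N := by
    have : (k : ℝ) + 1 ≤ N := by exact_mod_cast hk
    have : (0 : ℝ) ≤ l := by positivity
    linarith
  set d : ℝ := k - l with hd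
  have hx : Real.pi * k / N - Real.pi * l / N = Real.pi * (d / N) := by
    rw [hd]; ring
  rw [hx]
  refine le_trans ?_ (le_abs_self _)
  have hd1 : 1 / N ≤ d / N := by gcongr; linarith
  have hd2 : d / N ≤ 1 - 1 / N := by
    rw [le_sub_iff_add_le, ← add_div, div_le_one hN]
    exact h2
  have hN1 : 0 < 1 / (N : ℝ) := by positivity
  rcases le_total (d / N) (1 / 2) with hh | hh
  · have := Real.mul_le_sin (x := Real.pi * (d / N)) (by nlinarith) (by nlinarith)
    have e : 2 / Real.pi * (Real.pi * (d / N)) = 2 * (d / N) := by field_simp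
    rw [e] at this
    have e2 : 2 / (N : ℝ) = 2 * (1 / N) := by ring
    linarith
  · have := Real.mul_le_sin (x := Real.pi - Real.pi * (d / N)) (by nlinarith) (by nlinarith)
    have e : 2 / Real.pi * (Real.pi - Real.pi * (d / N)) = 2 * (1 - d / N) := by field_simp
    rw [e, Real.sin_pi_sub] at this
    have e2 : 2 / (N : ℝ) = 2 * (1 / N) := by ring
    linarith

theorem measureReal_abs_columnDot_cos_sin_eq {ν : Measure (Matrix.orthogonalGroup (Fin 2) ℝ)}
    [ν.IsMulLeftInvariant] (φ θ : ℝ) (j : Fin 2) (t : ℝ) :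
    ν.real {V | |columnDot (Real.cos φ) (Real.sin φ) j V| < t}
      = ν.real {V | |columnDot (Real.cos θ) (Real.sin θ) j V| < t} := by
  have h := map_mul_left_eq_self ν (rotation (φ - θ))
  conv_lhs => rw [← h]
  rw [map_measureReal_apply (continuous_const_mul _).measurable
    (measurableSet_abs_columnDot_lt _ _ _ _)]
  simp only [Set.preimage_ofPred_eq, columnDot_rotation_mul, sub_sub_cancel]

section LeftInvariant

variable {ν : Measure (Matrix.orthogonalGroup (Fin 2) ℝ)} [IsProbabilityMeasure ν]
  [ν.IsMulLeftInvariant]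

/-- A packing argument replaces the arcsine law: for `N = ⌊1 / t⌋` directions spaced by `π / N`, the
events are disjoint and equally likely, so each has probability at most `1 / N ≤ 2t`. -/
theorem measureReal_abs_columnDot_cos_sin_lt_le (φ : ℝ) (j : Fin 2) {t : ℝ} (ht : 0 < t) :
    ν.real {V | |columnDot (Real.cos φ) (Real.sin φ) j V| < t} ≤ 2 * t := by
  rcases lt_or_ge (1 / 2) t with h | h
  · exact measureReal_le_one.trans (by linarith)
  set N := ⌊1 / t⌋₊ with hN
  have hNle : (N : ℝ) ≤ 1 / t := Nat.floor_le (by positivity)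
  have hNlt : 1 / t < N + 1 := Nat.lt_floor_add_one _
  have h2 : 2 ≤ 1 / t := by rw [le_div_iff₀ ht]; linarith
  have hN0 : (0 : ℝ) < N := by linarith
  have htN : t ≤ 1 / N := by
    rw [le_div_iff₀ hN0, mul_comm, ← le_div_iff₀ ht]
    exact hNle
  let E : ℕ → Set (Matrix.orthogonalGroup (Fin 2) ℝ) := fun k =>
    {V | |columnDot (Real.cos (Real.pi * k / N)) (Real.sin (Real.pi * k / N)) j V| < t}
  have hdisj : Set.PairwiseDisjoint (↑(Finset.range N)) E := by
    intro k hk l hl hkl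
    rw [Function.onFun, Set.disjoint_left]
    intro V hVk hVl
    have h3 := abs_sin_sub_lt_of_abs_columnDot_lt hVk hVl
    have h4 := two_div_le_abs_sin_pi_mul_sub_div (Finset.mem_range.1 hk) (Finset.mem_range.1 hl) hkl
    have e2 : 2 / (N : ℝ) = 2 * (1 / N) := by ring
    linarith
  have hsum := measureReal_biUnion_finset (μ := ν) hdisj
    (fun k _ => measurableSet_abs_columnDot_lt _ _ _ _)
  have hE : ∀ k ∈ Finset.range N, ν.real (E k)
      = ν.real {V | |columnDot (Real.cos φ) (Real.sin φ) j V| < t} :=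
    fun k _ => measureReal_abs_columnDot_cos_sin_eq _ _ _ _
  rw [Finset.sum_congr rfl hE, Finset.sum_const, Finset.card_range, nsmul_eq_mul] at hsum
  have hone : ν.real (⋃ k ∈ Finset.range N, E k) ≤ 1 := measureReal_le_one
  rw [hsum] at hone
  have hp : ν.real {V | |columnDot (Real.cos φ) (Real.sin φ) j V| < t} ≤ 1 / N := by
    rw [le_div_iff₀ hN0, mul_comm]
    exact hone
  refine hp.trans ?_
  rw [div_le_iff₀ hN0]
  have : 1 / t ≤ 2 * N := by linarith
  rw [div_le_iff₀ ht] at this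
  linarith

/-- Under a rotation invariant law, `P(|⟨v, U e_j⟩| < t) ≤ 2 t / ‖v‖`. -/
theorem measureReal_abs_columnDot_lt_le {a b : ℝ} (hab : 0 < a ^ 2 + b ^ 2) (j : Fin 2) {t : ℝ}
    (ht : 0 < t) :
    ν.real {V | |columnDot a b j V| < t} ≤ 2 * (t / √(a ^ 2 + b ^ 2)) := by
  set r := √(a ^ 2 + b ^ 2) with hr
  have hr0 : 0 < r := Real.sqrt_pos.2 hab
  -- The complex argument supplies the polar angle of `(a, b)`.
  set z : ℂ := ⟨a, b⟩ with hz
  have hnorm : ‖z‖ = r := by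
    rw [Complex.norm_eq_sqrt_sq_add_sq]
  have hz0 : z ≠ 0 := by
    rw [← norm_pos_iff, hnorm]
    exact hr0
  have ha : a = r * Real.cos z.arg := by
    rw [Complex.cos_arg hz0, hnorm, mul_div_cancel₀ _ hr0.ne']
  have hb : b = r * Real.sin z.arg := by
    rw [Complex.sin_arg, hnorm, mul_div_cancel₀ _ hr0.ne']
  have hset : {V | |columnDot a b j V| < t}
      = {V | |columnDot (Real.cos z.arg) (Real.sin z.arg) j V| < t / r} := by
    ext V
    have : columnDot a b j V = r * columnDot (Real.cos z.arg) (Real.sin z.arg) j V := by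
      simp only [columnDot]
      linear_combination (V : Matrix (Fin 2) (Fin 2) ℝ) 0 j * ha
        + (V : Matrix (Fin 2) (Fin 2) ℝ) 1 j * hb
    simp only [Set.mem_ofPred_eq, this, abs_mul, abs_of_pos hr0]
    rw [lt_div_iff₀ hr0, mul_comm]
  rw [hset]
  exact measureReal_abs_columnDot_cos_sin_lt_le _ _ (by positivity)

/-- Union bound over the integer points of the disc of radius `β`. -/
theorem measureReal_exists_abs_columnDot_lt_le (j : Fin 2) {α β : ℝ} (hα : 0 < α) (hβ : 0 < β) :
    ν.real {V | ∃ x y : ℤ, (x, y) ≠ 0 ∧ (x : ℝ) ^ 2 + (y : ℝ) ^ 2 < β ^ 2 ∧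
      |columnDot x y j V| < α} ≤ 16 * (α * β) := by
  set N := ⌊β⌋₊ with hN
  have hsub : {V | ∃ x y : ℤ, (x, y) ≠ 0 ∧ (x : ℝ) ^ 2 + (y : ℝ) ^ 2 < β ^ 2 ∧
      |columnDot x y j V| < α}
      ⊆ ⋃ m ∈ Finset.Icc 1 N, ⋃ v ∈ (Finset.box m : Finset (ℤ × ℤ)),
        {V | |columnDot v.1 v.2 j V| < α} := by
    rintro V ⟨x, y, hxy, hlt, hV⟩
    simp only [Set.mem_iUnion]
    -- `Finset.box m` is the sup-norm sphere of radius `m`, so the shell index is the sup norm.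
    refine ⟨max x.natAbs y.natAbs, ?_, (x, y), Int.mem_box.2 rfl, hV⟩
    rw [Finset.mem_Icc]
    constructor
    · by_contra hcon
      apply hxy
      ext <;> simp <;> omega
    · apply Nat.le_floor
      have hx : |(x : ℝ)| ≤ β := abs_le_of_sq_le_sq (by nlinarith [sq_nonneg (y : ℝ)]) hβ.le
      have hy : |(y : ℝ)| ≤ β := abs_le_of_sq_le_sq (by nlinarith [sq_nonneg (x : ℝ)]) hβ.le
      rw [Nat.cast_max, Nat.cast_natAbs, Nat.cast_natAbs, Int.cast_abs, Int.cast_abs]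
      exact max_le hx hy
  have hshell : ∀ m ∈ Finset.Icc 1 N,
      ν.real (⋃ v ∈ (Finset.box m : Finset (ℤ × ℤ)), {V | |columnDot v.1 v.2 j V| < α})
        ≤ 16 * α := by
    intro m hm
    have hm1 : 1 ≤ m := (Finset.mem_Icc.1 hm).1
    have hm0 : (0 : ℝ) < m := by exact_mod_cast hm1
    refine (measureReal_biUnion_finset_le _ _).trans ?_
    have hterm : ∀ v ∈ (Finset.box m : Finset (ℤ × ℤ)),
        ν.real {V | |columnDot v.1 v.2 j V| < α} ≤ 2 * (α / m) := by
      intro v hv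
      rw [Int.mem_box] at hv
      have hsq : (m : ℝ) ^ 2 ≤ (v.1 : ℝ) ^ 2 + (v.2 : ℝ) ^ 2 := by
        rcases max_choice v.1.natAbs v.2.natAbs with h | h
        · rw [← hv, h, Nat.cast_natAbs, Int.cast_abs, sq_abs]
          nlinarith [sq_nonneg (v.2 : ℝ)]
        · rw [← hv, h, Nat.cast_natAbs, Int.cast_abs, sq_abs]
          nlinarith [sq_nonneg (v.1 : ℝ)]
      refine (measureReal_abs_columnDot_lt_le (lt_of_lt_of_le (by positivity) hsq) j hα).trans ?_
      gcongr
      exact Real.le_sqrt_of_sq_le hsq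
    refine (Finset.sum_le_card_nsmul _ _ _ hterm).trans ?_
    rw [Int.card_box (by omega), nsmul_eq_mul]
    push_cast
    apply le_of_eq
    field_simp
    ring
  calc _ ≤ _ := measureReal_mono hsub (measure_ne_top _ _)
    _ ≤ _ := measureReal_biUnion_finset_le _ _
    _ ≤ _ := Finset.sum_le_card_nsmul _ _ _ hshell
    _ = 16 * α * N := by rw [Nat.card_Icc, nsmul_eq_mul, Nat.add_sub_cancel]; ring
    _ ≤ 16 * α * β := by gcongr; exact Nat.floor_le hβ.le
    _ = 16 * (α * β) := by ring

end LeftInvariant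

/-! ### Outage probability under a left-invariant law -/

theorem binaryForm_conj_diagonal (V : Matrix.orthogonalGroup (Fin 2) ℝ) (d : Fin 2 → ℝ)
    (x y : ℝ) :
    binaryForm (((V : Matrix (Fin 2) (Fin 2) ℝ) * diagonal d * (V : Matrix (Fin 2) (Fin 2) ℝ)ᵀ) 0 0)
      (((V : Matrix (Fin 2) (Fin 2) ℝ) * diagonal d * (V : Matrix (Fin 2) (Fin 2) ℝ)ᵀ) 0 1)
      (((V : Matrix (Fin 2) (Fin 2) ℝ) * diagonal d * (V : Matrix (Fin 2) (Fin 2) ℝ)ᵀ) 1 1) x y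
      = d 0 * columnDot x y 0 V ^ 2 + d 1 * columnDot x y 1 V ^ 2 := by
  simp only [binaryForm, columnDot, Matrix.mul_apply, Fin.sum_univ_two, Matrix.transpose_apply,
    Matrix.diagonal_apply_eq, Matrix.diagonal_apply_ne _ Fin.zero_ne_one,
    Matrix.diagonal_apply_ne _ Fin.zero_ne_one.symm]
  ring

theorem posDef_conj_diagonal (V : Matrix.orthogonalGroup (Fin 2) ℝ) {d : Fin 2 → ℝ}
    (hd : ∀ i, 0 < d i) :
    ((V : Matrix (Fin 2) (Fin 2) ℝ) * diagonal d * (V : Matrix (Fin 2) (Fin 2) ℝ)ᵀ).PosDef := by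
  have hu : IsUnit (V : Matrix (Fin 2) (Fin 2) ℝ) :=
    ⟨⟨V, star (V : Matrix (Fin 2) (Fin 2) ℝ), (Matrix.mem_orthogonalGroup_iff (Fin 2) ℝ).1 V.2,
      (Matrix.mem_orthogonalGroup_iff' (Fin 2) ℝ).1 V.2⟩, rfl⟩
  have := (PosDef.diagonal hd).mul_mul_conjTranspose_same (Matrix.vecMul_injective_iff_isUnit.2 hu)
  rwa [conjTranspose_eq_transpose_of_trivial] at this

theorem transpose_mul_self_orthogonal {n : ℕ} (V : Matrix.orthogonalGroup (Fin n) ℝ) :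
    (V : Matrix (Fin n) (Fin n) ℝ)ᵀ * (V : Matrix (Fin n) (Fin n) ℝ) = 1 := by
  rw [← conjTranspose_eq_transpose_of_trivial]
  exact (Matrix.mem_orthogonalGroup_iff' (Fin n) ℝ).1 V.2

theorem self_mul_transpose_orthogonal {n : ℕ} (V : Matrix.orthogonalGroup (Fin n) ℝ) :
    (V : Matrix (Fin n) (Fin n) ℝ) * (V : Matrix (Fin n) (Fin n) ℝ)ᵀ = 1 := by
  rw [← conjTranspose_eq_transpose_of_trivial]
  exact (Matrix.mem_orthogonalGroup_iff (Fin n) ℝ).1 V.2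

theorem det_conj_orthogonal {n : ℕ} (V : Matrix.orthogonalGroup (Fin n) ℝ)
    (D : Matrix (Fin n) (Fin n) ℝ) :
    ((V : Matrix (Fin n) (Fin n) ℝ) * D * (V : Matrix (Fin n) (Fin n) ℝ)ᵀ).det = D.det := by
  rw [det_mul_right_comm, self_mul_transpose_orthogonal, one_mul]

theorem trace_conj_orthogonal {n : ℕ} (V : Matrix.orthogonalGroup (Fin n) ℝ)
    (D : Matrix (Fin n) (Fin n) ℝ) :
    ((V : Matrix (Fin n) (Fin n) ℝ) * D * (V : Matrix (Fin n) (Fin n) ℝ)ᵀ).trace = D.trace := by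
  rw [trace_mul_comm, ← Matrix.mul_assoc, transpose_mul_self_orthogonal, one_mul]

theorem add_eq_add_of_ne_fin_two {j k : Fin 2} (hjk : j ≠ k) (f : Fin 2 → ℝ) :
    f 0 + f 1 = f k + f j := by
  obtain ⟨rfl, rfl⟩ | ⟨rfl, rfl⟩ : j = 0 ∧ k = 1 ∨ j = 1 ∧ k = 0 := by omega
  · exact add_comm _ _
  · rfl

/-- The outage event forces a short integer vector to be nearly orthogonal to the dominant
eigenvector. -/
theorem exists_abs_columnDot_lt_of_lt_sucOptRateDU {d : Fin 2 → ℝ} (hd : ∀ i, 0 < d i)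
    {R T : ℝ} (hdet : d 0 * d 1 = 2 ^ (2 * R)) (hT : 1 ≤ T) {j k : Fin 2} (hjk : j ≠ k)
    (hle : d k ≤ d j) {V : Matrix.orthogonalGroup (Fin 2) ℝ}
    (h : R + T < sucOptRateDU (diagonal d) V) :
    ∃ x y : ℤ, (x, y) ≠ 0 ∧ (x : ℝ) ^ 2 + (y : ℝ) ^ 2 < √(2 ^ (R - T) / d k) ^ 2 ∧
      |columnDot x y j V| < √(2 ^ (R - T) / d j) := by
  rw [sucOptRateDU] at h
  have hM := add_sub_cancel (1 : Matrix (Fin 2) (Fin 2) ℝ)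
    ((V : Matrix (Fin 2) (Fin 2) ℝ) * diagonal d * (V : Matrix (Fin 2) (Fin 2) ℝ)ᵀ)
  obtain ⟨x, y, hxy, hlt⟩ := exists_binaryForm_lt_of_lt_sucOptRate
    (by rw [hM]; exact posDef_conj_diagonal V hd)
    (by rw [hM, det_conj_orthogonal, det_diagonal, Fin.prod_univ_two, hdet]) hT h
  rw [hM, binaryForm_conj_diagonal] at hlt
  have hsum := add_eq_add_of_ne_fin_two hjk fun i => d i * columnDot x y i V ^ 2
  have hnorm := add_eq_add_of_ne_fin_two hjk fun i => columnDot x y i V ^ 2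
  rw [columnDot_sq_add_sq] at hnorm
  rw [hsum] at hlt
  have hdj := hd j
  have hdk := hd k
  refine ⟨x, y, hxy, ?_, ?_⟩
  · rw [Real.sq_sqrt (by positivity), lt_div_iff₀ hdk, hnorm]
    nlinarith [sq_nonneg (columnDot x y j V)]
  · apply Real.lt_sqrt_of_sq_lt
    rw [sq_abs, lt_div_iff₀ hdj]
    nlinarith [mul_nonneg hdk.le (sq_nonneg (columnDot x y k V))]

theorem measureReal_lt_sucOptRateDU_le {d : Fin 2 → ℝ} (hd : ∀ i, 0 < d i)
    {R T : ℝ} (hdet : d 0 * d 1 = 2 ^ (2 * R)) (hT : 1 ≤ T)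
    (ν : Measure (Matrix.orthogonalGroup (Fin 2) ℝ)) [IsProbabilityMeasure ν]
    [ν.IsMulLeftInvariant] :
    ν.real {V | R + T < sucOptRateDU (diagonal d) V} ≤ 16 * 2 ^ (-T) := by
  obtain ⟨j, k, hjk, hle⟩ : ∃ j k : Fin 2, j ≠ k ∧ d k ≤ d j := by
    rcases le_total (d 0) (d 1) with h | h
    · exact ⟨1, 0, by decide, h⟩
    · exact ⟨0, 1, by decide, h⟩
  have hdj := hd j
  have hdk := hd k
  have hprod : d j * d k = (2 ^ R) ^ 2 := by
    have : d j * d k = d 0 * d 1 := by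
      fin_cases j <;> fin_cases k <;> simp_all [mul_comm]
    rw [this, hdet, ← Real.rpow_natCast, ← Real.rpow_mul zero_le_two]
    congr 1
    push_cast
    ring
  -- Only the product of the two radii enters the union bound; it depends on the eigenvalues only
  -- through the determinant, hence not on their spread.
  have hαβ : √(2 ^ (R - T) / d j) * √(2 ^ (R - T) / d k) = 2 ^ (-T) := by
    have hR : (0 : ℝ) < 2 ^ R := by positivity
    have e : (2 : ℝ) ^ (R - T) / d j * (2 ^ (R - T) / d k) = (2 ^ (-T)) ^ 2 := by
      rw [div_mul_div_comm, hprod, sub_eq_add_neg, Real.rpow_add zero_lt_two]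
      field_simp
    rw [← Real.sqrt_mul (by positivity), e, Real.sqrt_sq (by positivity)]
  calc _ ≤ _ := measureReal_mono (fun V hV =>
        exists_abs_columnDot_lt_of_lt_sucOptRateDU hd hdet hT hjk hle hV) (measure_ne_top _ _)
    _ ≤ _ := measureReal_exists_abs_columnDot_lt_le j (by positivity) (by positivity)
    _ = 16 * 2 ^ (-T) := by rw [hαβ]

/-! ### The circular real ensemble and precoding -/

theorem IsCRE.isMulLeftInvariant_map {n : ℕ} {Ω : Type*} [MeasurableSpace Ω]
    {U : Ω → Matrix.orthogonalGroup (Fin n) ℝ} {P : Measure Ω} (hU : IsCRE U P) :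
    (P.map U).IsMulLeftInvariant where
  map_mul_left_eq_self V := by
    rw [AEMeasurable.map_map_of_aemeasurable (continuous_const_mul V).measurable.aemeasurable
      hU.aemeasurable]
    exact (hU.left_invariant V).map_eq

theorem IsCRE.mul_right {n : ℕ} {Ω : Type*} [MeasurableSpace Ω]
    {U : Ω → Matrix.orthogonalGroup (Fin n) ℝ} {P : Measure Ω} (hU : IsCRE U P)
    (V : Matrix.orthogonalGroup (Fin n) ℝ) : IsCRE (fun ω => U ω * V) P where
  isProbabilityMeasure := hU.isProbabilityMeasure
  aemeasurable := (continuous_mul_const V).measurable.comp_aemeasurable hU.aemeasurable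
  left_invariant W := by
    have := (hU.left_invariant W).comp (continuous_mul_const V).measurable
    simpa only [Function.comp_def, mul_assoc] using this
  right_invariant W := by
    simp only [mul_assoc]
    exact (hU.right_invariant (V * W)).trans (hU.right_invariant V).symm

theorem IsCRE.measureReal_lt_sucOptRateDU_le {d : Fin 2 → ℝ} (hd : ∀ i, 0 < d i)
    {R : ℝ} (hdet : d 0 * d 1 = 2 ^ (2 * R)) {Ω : Type*} [MeasurableSpace Ω]
    {U : Ω → Matrix.orthogonalGroup (Fin 2) ℝ} {P : Measure Ω} (hU : IsCRE U P) (T : ℝ) :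
    P.real {ω | R + T < sucOptRateDU (diagonal d) (U ω)} ≤ 16 * 2 ^ (-T) := by
  have := hU.isProbabilityMeasure
  rcases lt_or_ge T 1 with hT | hT
  · have h : (2 : ℝ) ^ (-1 : ℝ) ≤ 2 ^ (-T) :=
      Real.rpow_le_rpow_of_exponent_le one_le_two (by linarith)
    rw [Real.rpow_neg_one] at h
    exact measureReal_le_one.trans (by linarith)
  · have := hU.isMulLeftInvariant_map
    have := Measure.isProbabilityMeasure_map hU.aemeasurable
    refine le_trans ?_ (IFSource.measureReal_lt_sucOptRateDU_le hd hdet hT (P.map U))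
    -- The inequality `le_map_apply` holds for arbitrary sets, so the outage set need not be shown
    -- measurable.
    exact ENNReal.toReal_mono (measure_ne_top _ _) (Measure.le_map_apply hU.aemeasurable _)

/-- Integrability is not needed, since a divergent integral is `0` by convention. -/
theorem trace_covariance_nonneg {n : ℕ} {S : Type*} [MeasurableSpace S]
    (x : S → EuclideanSpace ℝ (Fin n)) (μ : Measure S) : 0 ≤ (covariance x μ).trace :=
  Finset.sum_nonneg fun _ _ => integral_nonneg fun _ => mul_self_nonneg _

/-- Since `W Wᵀ = 1`, `I + W K Wᵀ = W (I + K) Wᵀ = (W V) D (W V)ᵀ`. -/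
theorem sucOptRate_conj_eq_sucOptRateDU {n : ℕ} {K D : Matrix (Fin n) (Fin n) ℝ}
    {V : Matrix.orthogonalGroup (Fin n) ℝ}
    (h : 1 + K = (V : Matrix (Fin n) (Fin n) ℝ) * D * (V : Matrix (Fin n) (Fin n) ℝ)ᵀ)
    (W : Matrix.orthogonalGroup (Fin n) ℝ) :
    sucOptRate ((W : Matrix (Fin n) (Fin n) ℝ) * K * (W : Matrix (Fin n) (Fin n) ℝ)ᵀ)
      = sucOptRateDU D (W * V) := by
  rw [sucOptRateDU, eq_sub_of_add_eq' h, Submonoid.coe_mul, transpose_mul, mul_sub, sub_mul,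
    mul_one, self_mul_transpose_orthogonal]
  simp only [Matrix.mul_assoc]

end IFSource

/-- For a two-dimensional Gaussian source, `I + K_xx = V D Vᵀ` with `D ∈ 𝔻(R_BT, 2)`, and `U`
drawn from the CRE, the outage probability of successive integer-forcing is at most
`2π(5 + 3√2) 2^{-ΔR}`, both for the rate `R(D, U)` and for the source precoded by `U`. -/
theorem mainTheorem2
    {S : Type*} [MeasurableSpace S] (μ : MeasureTheory.Measure S)
    (x : S → EuclideanSpace ℝ (Fin 2)) (hx : ProbabilityTheory.HasGaussianLaw x μ)
    (hx0 : ∫ s, x s ∂μ = 0)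
    (V : Matrix.orthogonalGroup (Fin 2) ℝ) (D : Matrix (Fin 2) (Fin 2) ℝ)
    (hVD : 1 + IFSource.covariance x μ
      = (V : Matrix (Fin 2) (Fin 2) ℝ) * D * (V : Matrix (Fin 2) (Fin 2) ℝ).transpose)
    (RBT : ℝ) (hD : D ∈ IFSource.diagClass RBT 2)
    {Ω : Type*} [MeasurableSpace Ω] (P : MeasureTheory.Measure Ω)
    (U : Ω → Matrix.orthogonalGroup (Fin 2) ℝ) (hU : IFSource.IsCRE U P) (ΔR : ℝ) :
    P.real {ω | IFSource.sucOptRateDU D (U ω) > RBT + ΔR}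
        ≤ 2 * Real.pi * (5 + 3 * Real.sqrt 2) * (2 : ℝ) ^ (-ΔR) ∧
    P.real {ω | IFSource.sucOptRate ((U ω : Matrix (Fin 2) (Fin 2) ℝ) * IFSource.covariance x μ
          * (U ω : Matrix (Fin 2) (Fin 2) ℝ).transpose) > RBT + ΔR}
        ≤ 2 * Real.pi * (5 + 3 * Real.sqrt 2) * (2 : ℝ) ^ (-ΔR) := by
  have hconst : (16 : ℝ) ≤ 2 * Real.pi * (5 + 3 * Real.sqrt 2) := by
    nlinarith [Real.pi_gt_three, Real.sqrt_nonneg 2]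
  have hbound : 16 * (2 : ℝ) ^ (-ΔR) ≤ 2 * Real.pi * (5 + 3 * Real.sqrt 2) * 2 ^ (-ΔR) :=
    mul_le_mul_of_nonneg_right hconst (by positivity)
  obtain ⟨hdiag, hdet⟩ := hD
  obtain ⟨d, rfl⟩ : ∃ d, Matrix.diagonal d = D := ⟨D.diag, hdiag.diagonal_diag⟩
  rw [Matrix.det_diagonal, Fin.prod_univ_two] at hdet
  -- The trace of `D` is `2 + tr K_xx > 0`; with a positive determinant this makes both eigenvalues
  -- positive.
  have htrace : 0 < d 0 + d 1 := by
    have h := congrArg Matrix.trace hVD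
    rw [IFSource.trace_conj_orthogonal, Matrix.trace_add, Matrix.trace_one, Matrix.trace_diagonal,
      Fin.sum_univ_two, Fintype.card_fin] at h
    have := IFSource.trace_covariance_nonneg x μ
    push_cast at h
    linarith
  have hprod : 0 < d 0 * d 1 := by rw [hdet]; positivity
  have hd : ∀ i, 0 < d i := by
    rcases pos_and_pos_or_neg_and_neg_of_mul_pos hprod with h | h
    · exact Fin.forall_fin_two.2 h
    · linarith
  refine ⟨(hU.measureReal_lt_sucOptRateDU_le hd hdet ΔR).trans hbound, ?_⟩
  simp only [IFSource.sucOptRate_conj_eq_sucOptRateDU hVD]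
  exact ((hU.mul_right V).measureReal_lt_sucOptRateDU_le hd hdet ΔR).trans hbound
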